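/- **Proposition.** Let $d\in\mathbb{N}$ and let $r,q$ be real numbers with $q\ge 2$ and $1\le r\le q$. For $x\in\mathbb{R}^d$ put $\|x\|_r=\left(\sum_{i=1}^d|x_i|^r\right)^{1/r}$ and $G(x)=\|x\|_r^q/q$, and let $$G^{*}(x)=\sup_{y\in\mathbb{R}^d}\left(\langle x,y\rangle-G(y)\right)$$ be the convex conjugate of $G$ (which is nonnegative, since $G(0)=0$). Then $G^{*}$ satisfies the generalized Nemirovsky inequality: there is a finite constant $C\ge 0$, depending only on $(d,r,q)$, such that for every $m$ and all independent mean-zero (in particular integrable) $\mathbb{R}^d$-valued random vectors $Z_1,\dots,Z_m$ on a common probability space, $$\mathbb{E}\,G^{*}\left(\sum_{j=1}^m Z_j\right)\le C\sum_{j=1}^m\mathbb{E}\,G^{*}(Z_j),$$ where the expectations take values in $[0,\infty]$. -/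

import Mathlib

open MeasureTheory ProbabilityTheory
open scoped NNReal ENNReal

universe u v

/-- The norm `‖x‖_r = (∑ i, |x i| ^ r) ^ (1 / r)` on `ℝ^d`, for a finite exponent `r`
(it is a norm for `1 ≤ r`). -/
noncomputable def lrNorm {d : ℕ} (r : ℝ) (x : EuclideanSpace ℝ (Fin d)) : ℝ :=
  (∑ i, |x i| ^ r) ^ (1 / r)

/-- The function `G(x) = ‖x‖_r ^ q / q` on `ℝ^d`. -/
noncomputable def powerG (d : ℕ) (r q : ℝ) (x : EuclideanSpace ℝ (Fin d)) : ℝ :=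
  lrNorm r x ^ q / q

/-- The convex conjugate `G^*(x) = sup_y (⟪x, y⟫ - G y)` of a real-valued function on a real
inner product space; the supremum is taken in the extended reals. -/
noncomputable def convexConjugate {E : Type v} [NormedAddCommGroup E] [InnerProductSpace ℝ E]
    (G : E → ℝ) (x : E) : EReal :=
  ⨆ y : E, ((inner ℝ x y - G y : ℝ) : EReal)

/-- If `G 0 = 0` then the conjugate is nonnegative, so that it is faithfully recorded by its
`EReal.toENNReal`. -/
theorem convexConjugate_nonneg {E : Type v} [NormedAddCommGroup E] [InnerProductSpace ℝ E]
    (G : E → ℝ) (hG : G 0 = 0) (x : E) : 0 ≤ convexConjugate G x := by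
  have h := le_iSup (fun y : E => ((inner ℝ x y - G y : ℝ) : EReal)) 0
  rw [inner_zero_right, hG, sub_zero, EReal.coe_zero] at h
  exact h

/-- The generalized Nemirovsky inequality for `G` with constant `C`: for all independent mean-zero
random vectors `Z_1, …, Z_m` in the Hilbert space `E`, on any probability space,
`𝔼 G^*(∑ Z_j) ≤ C ∑ 𝔼 G^*(Z_j)`. It is meant for `G` with `G 0 = 0`, when `G^*` takes values in
`[0, ∞]`; both expectations are then integrals of `[0, ∞]`-valued functions. -/
def GeneralizedNemirovsky {E : Type v} [NormedAddCommGroup E] [InnerProductSpace ℝ E]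
    [CompleteSpace E] [MeasurableSpace E] [BorelSpace E] (G : E → ℝ) (C : ℝ≥0) : Prop :=
  ∀ (Ω : Type u) [MeasurableSpace Ω] (P : Measure Ω) [IsProbabilityMeasure P]
    (m : ℕ) (Z : Fin m → Ω → E),
    (∀ j, Measurable (Z j)) → (∀ j, Integrable (Z j) P) → (∀ j, ∫ ω, Z j ω ∂P = 0) →
    iIndepFun Z P →
    ∫⁻ ω, (convexConjugate G (∑ j, Z j ω)).toENNReal ∂P ≤
      (C : ℝ≥0∞) * ∑ j, ∫⁻ ω, (convexConjugate G (Z j ω)).toENNReal ∂P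

/-! Only the growth of `G` matters. All norms on `ℝ^d` are equivalent, so `G^*` lies between two
positive multiples of the Euclidean `‖x‖ ^ p`, where `1/p + 1/q = 1`, and it suffices to treat `‖x‖
^ p`. Since `q ≥ 2` gives `1 < p ≤ 2`, this power is smooth enough: `norm_add_rpow_le` bounds `‖x +
y‖ ^ p` by its first-order expansion at `x` plus `6 * ‖y‖ ^ p`. For independent summands with `y`
centred, the linear term has mean zero, which yields the von Bahr–Esseen inequality by induction. -/

/-! ### First-order expansion of `‖x‖ ^ p`. -/

section SmoothPower

variable {E : Type*} [NormedAddCommGroup E] [InnerProductSpace ℝ E]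

/-- Up to the factor `p`, the gradient of `x ↦ ‖x‖ ^ p`. -/
noncomputable def dualityMap (p : ℝ) (x : E) : E := ‖x‖ ^ (p - 2) • x

theorem norm_dualityMap {p : ℝ} (hp : 1 < p) (x : E) : ‖dualityMap p x‖ = ‖x‖ ^ (p - 1) := by
  rcases eq_or_ne x 0 with rfl | hx
  · simp [dualityMap, Real.zero_rpow (by linarith : p - 1 ≠ 0)]
  · have hx' : 0 < ‖x‖ := norm_pos_iff.2 hx
    rw [dualityMap, norm_smul, Real.norm_of_nonneg (by positivity), ← Real.rpow_add_one hx'.ne']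
    congr 1
    ring

theorem inner_dualityMap_self {p : ℝ} (hp : 1 < p) (x : E) :
    inner ℝ x (dualityMap p x) = ‖x‖ ^ p := by
  rcases eq_or_ne x 0 with rfl | hx
  · simp [Real.zero_rpow (by linarith : p ≠ 0)]
  · have hx' : 0 < ‖x‖ := norm_pos_iff.2 hx
    rw [dualityMap, real_inner_smul_right, real_inner_self_eq_norm_sq, ← Real.rpow_natCast ‖x‖ 2,
      ← Real.rpow_add hx']
    congr 1
    push_cast
    ring

/-- When `y` dominates, every term is of order `‖y‖ ^ p`: the left side costs at most 4, the linear
term at most `p ≤ 2`. -/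
theorem norm_add_rpow_le_of_lt {p : ℝ} (hp : 1 < p) (hp2 : p ≤ 2) {x y : E} (hxy : ‖x‖ < ‖y‖) :
    ‖x + y‖ ^ p ≤ ‖x‖ ^ p + p * inner ℝ (dualityMap p x) y + 6 * ‖y‖ ^ p := by
  have hy : 0 < ‖y‖ := (norm_nonneg x).trans_lt hxy
  have h1 : ‖x + y‖ ^ p ≤ 4 * ‖y‖ ^ p := by
    calc ‖x + y‖ ^ p ≤ (2 * ‖y‖) ^ p := by
          gcongr
          linarith [norm_add_le x y]
      _ = 2 ^ p * ‖y‖ ^ p := Real.mul_rpow zero_le_two hy.le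
      _ ≤ 4 * ‖y‖ ^ p := by
          gcongr
          calc (2 : ℝ) ^ p ≤ 2 ^ (2 : ℝ) := Real.rpow_le_rpow_of_exponent_le one_le_two hp2
            _ = 4 := by norm_num
  have h2 : |inner ℝ (dualityMap p x) y| ≤ ‖y‖ ^ p := by
    calc |inner ℝ (dualityMap p x) y| ≤ ‖dualityMap p x‖ * ‖y‖ := abs_real_inner_le_norm _ _
      _ ≤ ‖y‖ ^ (p - 1) * ‖y‖ := by
          rw [norm_dualityMap hp]
          gcongr
      _ = ‖y‖ ^ p := by
          rw [← Real.rpow_add_one hy.ne']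
          congr 1
          ring
  have h3 : 0 ≤ ‖x‖ ^ p := by positivity
  have h4 : 0 ≤ ‖y‖ ^ p := by positivity
  nlinarith [neg_le_of_abs_le h2]

/-- Write `‖x + y‖ ^ 2 = ‖x‖ ^ 2 * (1 + t)` and apply Bernoulli's inequality with exponent `p / 2 ≤
1`. The inner product in `t` gives the linear term; the rest is controlled by `‖x‖ ^ (p - 2) ≤ ‖y‖ ^
(p - 2)`, as `p ≤ 2`. -/
theorem norm_add_rpow_le_of_le {p : ℝ} (hp : 1 < p) (hp2 : p ≤ 2) {x y : E} (hxy : ‖y‖ ≤ ‖x‖) :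
    ‖x + y‖ ^ p ≤ ‖x‖ ^ p + p * inner ℝ (dualityMap p x) y + ‖y‖ ^ p := by
  have hp0 : p ≠ 0 := by linarith
  rcases eq_or_ne y 0 with rfl | hy
  · simp [Real.zero_rpow hp0]
  have hy' : 0 < ‖y‖ := norm_pos_iff.2 hy
  have hx : 0 < ‖x‖ := hy'.trans_le hxy
  set t : ℝ := (2 * inner ℝ x y + ‖y‖ ^ 2) / ‖x‖ ^ 2 with ht
  have hsq : ‖x + y‖ ^ 2 = ‖x‖ ^ 2 * (1 + t) := by
    rw [norm_add_sq_real, ht]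
    field_simp
    ring
  have ht1 : 0 ≤ 1 + t :=
    nonneg_of_mul_nonneg_right (hsq ▸ sq_nonneg ‖x + y‖) (by positivity)
  have key : ‖x + y‖ ^ p = ‖x‖ ^ p * (1 + t) ^ (p / 2) := by
    have h (a : ℝ) (ha : 0 ≤ a) : a ^ p = (a ^ 2) ^ (p / 2) := by
      rw [← Real.rpow_natCast a 2, ← Real.rpow_mul ha]
      congr 1
      push_cast
      ring
    rw [h _ (norm_nonneg (x + y)), hsq, Real.mul_rpow (by positivity) ht1, ← h _ hx.le]
  have hpow : ‖x‖ ^ p = ‖x‖ ^ (p - 2) * ‖x‖ ^ 2 := by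
    rw [← Real.rpow_natCast ‖x‖ 2, ← Real.rpow_add hx]
    congr 1
    push_cast
    ring
  have hy2 : ‖x‖ ^ (p - 2) * ‖y‖ ^ 2 ≤ ‖y‖ ^ p := by
    calc ‖x‖ ^ (p - 2) * ‖y‖ ^ 2 ≤ ‖y‖ ^ (p - 2) * ‖y‖ ^ 2 := by
          gcongr ?_ * _
          exact Real.rpow_le_rpow_of_nonpos hy' hxy (by linarith)
      _ = ‖y‖ ^ p := by
          rw [← Real.rpow_natCast ‖y‖ 2, ← Real.rpow_add hy']
          congr 1
          push_cast
          ring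
  have hy2' : 0 ≤ ‖x‖ ^ (p - 2) * ‖y‖ ^ 2 := by positivity
  calc ‖x + y‖ ^ p = ‖x‖ ^ p * (1 + t) ^ (p / 2) := key
    _ ≤ ‖x‖ ^ p * (1 + p / 2 * t) := by
        gcongr
        exact rpow_one_add_le_one_add_mul_self (by linarith) (by linarith) (by linarith)
    _ = ‖x‖ ^ p + p * (‖x‖ ^ (p - 2) * inner ℝ x y) + p / 2 * (‖x‖ ^ (p - 2) * ‖y‖ ^ 2) := by
        rw [hpow, ht]
        field_simp
        ring
    _ ≤ ‖x‖ ^ p + p * inner ℝ (dualityMap p x) y + ‖y‖ ^ p := by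
        rw [dualityMap, real_inner_smul_left]
        nlinarith

theorem norm_add_rpow_le {p : ℝ} (hp : 1 < p) (hp2 : p ≤ 2) (x y : E) :
    ‖x + y‖ ^ p ≤ ‖x‖ ^ p + p * inner ℝ (dualityMap p x) y + 6 * ‖y‖ ^ p := by
  rcases lt_or_ge ‖x‖ ‖y‖ with h | h
  · exact norm_add_rpow_le_of_lt hp hp2 h
  · have : 0 ≤ ‖y‖ ^ p := by positivity
    linarith [norm_add_rpow_le_of_le hp hp2 h]

end SmoothPower

/-! ### The von Bahr–Esseen inequality. -/

section VonBahrEsseen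

variable {E : Type*} [NormedAddCommGroup E] [InnerProductSpace ℝ E] [CompleteSpace E]
  [MeasurableSpace E] [BorelSpace E] [SecondCountableTopology E]
  {Ω : Type*} [MeasurableSpace Ω] {P : Measure Ω} [IsProbabilityMeasure P]

omit [CompleteSpace E] in
theorem measurable_dualityMap (p : ℝ) : Measurable (dualityMap p : E → E) := by
  unfold dualityMap
  fun_prop

omit [CompleteSpace E] in
theorem integrable_dualityMap {p : ℝ} (hp : 1 < p) (hp2 : p ≤ 2) {X : Ω → E}
    (hX : Integrable X P) : Integrable (fun ω => dualityMap p (X ω)) P := by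
  refine Integrable.mono' ((integrable_const (1 : ℝ)).add hX.norm)
    ((measurable_dualityMap p).comp_aemeasurable hX.aemeasurable).aestronglyMeasurable
    (Filter.Eventually.of_forall fun ω => ?_)
  rw [norm_dualityMap hp, Pi.add_apply]
  rcases le_total ‖X ω‖ 1 with h | h
  · linarith [Real.rpow_le_one (norm_nonneg (X ω)) h (by linarith : 0 ≤ p - 1), norm_nonneg (X ω)]
  · have h1 : ‖X ω‖ ^ (p - 1) ≤ ‖X ω‖ :=
      Real.rpow_le_self_of_one_le h (by linarith)
    linarith

theorem integral_norm_add_rpow_le {p : ℝ} (hp : 1 < p) (hp2 : p ≤ 2) {X Y : Ω → E}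
    (hX : Integrable X P) (hY : Integrable Y P) (hY0 : ∫ ω, Y ω ∂P = 0) (hXY : IndepFun X Y P)
    (hXp : Integrable (fun ω => ‖X ω‖ ^ p) P) (hYp : Integrable (fun ω => ‖Y ω‖ ^ p) P) :
    Integrable (fun ω => ‖X ω + Y ω‖ ^ p) P ∧
      ∫ ω, ‖X ω + Y ω‖ ^ p ∂P ≤ ∫ ω, ‖X ω‖ ^ p ∂P + 6 * ∫ ω, ‖Y ω‖ ^ p ∂P := by
  have hind : IndepFun (fun ω => dualityMap p (X ω)) Y P :=
    hXY.comp (measurable_dualityMap p) measurable_id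
  have hD := integrable_dualityMap hp hp2 hX
  have hI : Integrable (fun ω => inner ℝ (dualityMap p (X ω)) (Y ω)) P :=
    hind.integrable_bilin hD hY (innerSL ℝ)
  have hI0 : ∫ ω, inner ℝ (dualityMap p (X ω)) (Y ω) ∂P = 0 := by
    have h := hind.integral_bilin hD hY (innerSL ℝ)
    rw [hY0, map_zero] at h
    exact h
  have hsum : Integrable
      (fun ω => ‖X ω‖ ^ p + p * inner ℝ (dualityMap p (X ω)) (Y ω) + 6 * ‖Y ω‖ ^ p) P :=
    (hXp.add (hI.const_mul p)).add (hYp.const_mul 6)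
  have hle (ω : Ω) := norm_add_rpow_le hp hp2 (X ω) (Y ω)
  have hint : Integrable (fun ω => ‖X ω + Y ω‖ ^ p) P := by
    refine hsum.mono' ?_ (Filter.Eventually.of_forall fun ω => ?_)
    · exact ((hX.add hY).aemeasurable.norm.pow_const p).aestronglyMeasurable
    · rw [Real.norm_of_nonneg (by positivity)]
      exact hle ω
  refine ⟨hint, (integral_mono hint hsum hle).trans_eq ?_⟩
  rw [integral_add (by exact hXp.add (hI.const_mul p)) (hYp.const_mul 6),
    integral_add hXp (hI.const_mul p), integral_const_mul, integral_const_mul, hI0]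
  ring

/-- The factor 6 falls only on the newly added summand, so it does not compound along the induction.
-/
theorem integral_norm_sum_rpow_le {ι : Type*} {p : ℝ} (hp : 1 < p) (hp2 : p ≤ 2) {Z : ι → Ω → E}
    (hm : ∀ j, Measurable (Z j)) (hi : ∀ j, Integrable (Z j) P) (h0 : ∀ j, ∫ ω, Z j ω ∂P = 0)
    (hind : iIndepFun Z P) (hZp : ∀ j, Integrable (fun ω => ‖Z j ω‖ ^ p) P) (s : Finset ι) :
    Integrable (fun ω => ‖∑ j ∈ s, Z j ω‖ ^ p) P ∧
      ∫ ω, ‖∑ j ∈ s, Z j ω‖ ^ p ∂P ≤ 6 * ∑ j ∈ s, ∫ ω, ‖Z j ω‖ ^ p ∂P := by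
  classical
  induction s using Finset.induction_on with
  | empty => simp [Real.zero_rpow (by linarith : p ≠ 0)]
  | insert j s hj ih =>
    have hXY : IndepFun (fun ω => ∑ i ∈ s, Z i ω) (Z j) P := by
      simpa only [Finset.sum_fn] using hind.indepFun_finsetSum_of_notMem hm hj
    have h := integral_norm_add_rpow_le hp hp2 (integrable_finsetSum s fun i _ => hi i) (hi j)
      (h0 j) hXY ih.1 (hZp j)
    simp only [Finset.sum_insert hj, add_comm (Z j _)]
    exact ⟨h.1, by linarith [h.2, ih.2]⟩

/-- The von Bahr–Esseen inequality in a Hilbert space, for expectations in `[0, ∞]`. -/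
theorem lintegral_norm_sum_rpow_le {ι : Type*} [Fintype ι] {p : ℝ} (hp : 1 < p) (hp2 : p ≤ 2)
    {Z : ι → Ω → E} (hm : ∀ j, Measurable (Z j)) (hi : ∀ j, Integrable (Z j) P)
    (h0 : ∀ j, ∫ ω, Z j ω ∂P = 0) (hind : iIndepFun Z P) :
    ∫⁻ ω, ENNReal.ofReal (‖∑ j, Z j ω‖ ^ p) ∂P ≤
      6 * ∑ j, ∫⁻ ω, ENNReal.ofReal (‖Z j ω‖ ^ p) ∂P := by
  -- An infinite moment makes the right side `⊤`; otherwise all moments are finite and Bochner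
  -- integrals apply.
  by_cases htop : ∃ j, ∫⁻ ω, ENNReal.ofReal (‖Z j ω‖ ^ p) ∂P = ⊤
  · obtain ⟨j, hj⟩ := htop
    rw [ENNReal.sum_eq_top.2 ⟨j, Finset.mem_univ j, hj⟩, ENNReal.mul_top (by norm_num)]
    exact le_top
  · push Not at htop
    have hnn {X : Ω → E} : 0 ≤ᵐ[P] fun ω => ‖X ω‖ ^ p :=
      Filter.Eventually.of_forall fun ω => by positivity
    have hZp (j : ι) : Integrable (fun ω => ‖Z j ω‖ ^ p) P := by
      refine ⟨((hm j).norm.pow_const p).aestronglyMeasurable, ?_⟩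
      rw [hasFiniteIntegral_iff_ofReal hnn]
      exact (htop j).lt_top
    obtain ⟨h1, h2⟩ := integral_norm_sum_rpow_le hp hp2 hm hi h0 hind hZp Finset.univ
    simp only [← ofReal_integral_eq_lintegral_ofReal (hZp _) hnn]
    rw [← ofReal_integral_eq_lintegral_ofReal h1 hnn,
      ← ENNReal.ofReal_sum_of_nonneg fun j _ => integral_nonneg fun ω => by positivity]
    refine (ENNReal.ofReal_le_ofReal h2).trans_eq ?_
    rw [ENNReal.ofReal_mul (by norm_num)]
    norm_num

end VonBahrEsseen

/-! ### Two-sided bounds for the conjugate. -/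

section Conjugate

variable {E : Type*} [NormedAddCommGroup E] [InnerProductSpace ℝ E]

/-- Cauchy–Schwarz, then Young's inequality for the product of `B * ‖x‖` and `N y`. -/
theorem convexConjugate_le_of_norm_le {p q B : ℝ} (hpq : p.HolderConjugate q) (hB : 0 ≤ B)
    {N : E → ℝ} (hN0 : ∀ y, 0 ≤ N y) (hN : ∀ y, ‖y‖ ≤ B * N y) (x : E) :
    convexConjugate (fun y => N y ^ q / q) x ≤ ((B ^ p / p * ‖x‖ ^ p : ℝ) : EReal) := by
  refine iSup_le fun y => EReal.coe_le_coe_iff.2 ?_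
  have h1 : inner ℝ x y ≤ B * ‖x‖ * N y :=
    calc inner ℝ x y ≤ ‖x‖ * ‖y‖ := real_inner_le_norm x y
      _ ≤ ‖x‖ * (B * N y) := by
          gcongr
          exact hN y
      _ = B * ‖x‖ * N y := by ring
  have h2 := Real.young_inequality_of_nonneg (by positivity : 0 ≤ B * ‖x‖) (hN0 y) hpq
  rw [Real.mul_rpow hB (norm_nonneg x)] at h2
  have h3 : B ^ p / p * ‖x‖ ^ p = B ^ p * ‖x‖ ^ p / p := by ring
  linarith

theorem le_convexConjugate_of_le_norm {p q A : ℝ} (hpq : p.HolderConjugate q) (hA : 0 < A)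
    {N : E → ℝ} (hN0 : ∀ y, 0 ≤ N y) (hN : ∀ y, N y ≤ A * ‖y‖) (x : E) :
    ((A ^ (-p) / p * ‖x‖ ^ p : ℝ) : EReal) ≤ convexConjugate (fun y => N y ^ q / q) x := by
  -- This test vector maximizes `⟪x, y⟫ - (A * ‖y‖) ^ q / q` over `y`.
  refine le_iSup_of_le (A ^ (-p) • dualityMap p x) (EReal.coe_le_coe_iff.2 ?_)
  have hp := hpq.lt
  have hq := hpq.symm.pos
  have hpq' : (p - 1) * q = p := hpq.sub_one_mul_conj
  have hinv : p⁻¹ + q⁻¹ = 1 := hpq.inv_add_inv_eq_one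
  have h1 : N (A ^ (-p) • dualityMap p x) ^ q ≤ A ^ (-p) * ‖x‖ ^ p := by
    calc N (A ^ (-p) • dualityMap p x) ^ q
        ≤ (A * ‖A ^ (-p) • dualityMap p x‖) ^ q :=
          Real.rpow_le_rpow (hN0 _) (hN _) hq.le
      _ = (A ^ (1 - p) * ‖x‖ ^ (p - 1)) ^ q := by
          rw [norm_smul, norm_dualityMap hp, Real.norm_of_nonneg (by positivity), ← mul_assoc,
            sub_eq_add_neg 1 p, Real.rpow_add hA, Real.rpow_one]
      _ = A ^ (-p) * ‖x‖ ^ p := by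
          rw [Real.mul_rpow (by positivity) (by positivity), ← Real.rpow_mul hA.le,
            ← Real.rpow_mul (norm_nonneg x), hpq',
            show (1 - p) * q = -p by linarith]
  rw [real_inner_smul_right, inner_dualityMap_self hp]
  have h2 : A ^ (-p) / p * ‖x‖ ^ p + A ^ (-p) * ‖x‖ ^ p / q = A ^ (-p) * ‖x‖ ^ p := by
    linear_combination (A ^ (-p) * ‖x‖ ^ p) * hinv
  have h3 := div_le_div_of_nonneg_right h1 hq.le
  linarith

theorem generalizedNemirovsky_of_norm_equiv [CompleteSpace E] [MeasurableSpace E] [BorelSpace E]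
    [SecondCountableTopology E] {q A B : ℝ} (hq : 2 ≤ q) (hA : 0 < A) (hB : 0 ≤ B) {N : E → ℝ}
    (hN0 : ∀ y, 0 ≤ N y) (hNA : ∀ y, N y ≤ A * ‖y‖) (hNB : ∀ y, ‖y‖ ≤ B * N y) :
    ∃ C : ℝ≥0, GeneralizedNemirovsky.{u} (fun y => N y ^ q / q) C := by
  set p := q.conjExponent
  have hpq : p.HolderConjugate q := (Real.HolderConjugate.conjExponent (by linarith)).symm
  have hp1 := hpq.lt
  have hp0 := hpq.pos
  -- Here `q ≥ 2` enters, through `(q - 1) * p = q`.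
  have hp2 : p ≤ 2 := by
    have := hpq.symm.sub_one_mul_conj
    nlinarith
  set a : ℝ := A ^ (-p) / p
  set b : ℝ := B ^ p / p
  have ha : 0 < a := by positivity
  have hb : 0 ≤ b := by positivity
  have hupper (x : E) : (convexConjugate (fun y => N y ^ q / q) x).toENNReal ≤
      ENNReal.ofReal b * ENNReal.ofReal (‖x‖ ^ p) := by
    have h := EReal.toENNReal_le_toENNReal (convexConjugate_le_of_norm_le hpq hB hN0 hNB x)
    rwa [EReal.real_coe_toENNReal, ENNReal.ofReal_mul hb] at h
  have hlower (x : E) : ENNReal.ofReal (‖x‖ ^ p) ≤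
      ENNReal.ofReal a⁻¹ * (convexConjugate (fun y => N y ^ q / q) x).toENNReal := by
    have h := EReal.toENNReal_le_toENNReal (le_convexConjugate_of_le_norm hpq hA hN0 hNA x)
    rw [EReal.real_coe_toENNReal] at h
    calc ENNReal.ofReal (‖x‖ ^ p) = ENNReal.ofReal a⁻¹ * ENNReal.ofReal (a * ‖x‖ ^ p) := by
          rw [← ENNReal.ofReal_mul (by positivity), inv_mul_cancel_left₀ ha.ne']
      _ ≤ _ := by gcongr
  refine ⟨b.toNNReal * 6 * a⁻¹.toNNReal, ?_⟩
  intro Ω _ P _ m Z hm hi h0 hind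
  calc ∫⁻ ω, (convexConjugate (fun y => N y ^ q / q) (∑ j, Z j ω)).toENNReal ∂P
      ≤ ∫⁻ ω, ENNReal.ofReal b * ENNReal.ofReal (‖∑ j, Z j ω‖ ^ p) ∂P :=
        lintegral_mono fun ω => hupper _
    _ = ENNReal.ofReal b * ∫⁻ ω, ENNReal.ofReal (‖∑ j, Z j ω‖ ^ p) ∂P :=
        lintegral_const_mul' _ _ ENNReal.ofReal_ne_top
    _ ≤ ENNReal.ofReal b * (6 * ∑ j, ∫⁻ ω, ENNReal.ofReal (‖Z j ω‖ ^ p) ∂P) := by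
        gcongr
        exact lintegral_norm_sum_rpow_le hp1 hp2 hm hi h0 hind
    _ ≤ ENNReal.ofReal b * (6 * ∑ j, ENNReal.ofReal a⁻¹ *
          ∫⁻ ω, (convexConjugate (fun y => N y ^ q / q) (Z j ω)).toENNReal ∂P) := by
        gcongr with j
        rw [← lintegral_const_mul' _ _ ENNReal.ofReal_ne_top]
        exact lintegral_mono fun ω => hlower _
    _ = _ := by
        rw [← Finset.mul_sum]
        simp only [ENNReal.ofReal, ENNReal.coe_mul, mul_assoc]
        norm_num

end Conjugate

/-! ### Comparison with the Euclidean norm. -/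

section LrNorm

variable {d : ℕ} {r : ℝ}

theorem lrNorm_nonneg (r : ℝ) (x : EuclideanSpace ℝ (Fin d)) : 0 ≤ lrNorm r x :=
  Real.rpow_nonneg (Finset.sum_nonneg fun _ _ => by positivity) _

theorem lrNorm_le_mul_norm (hr : 0 < r) (x : EuclideanSpace ℝ (Fin d)) :
    lrNorm r x ≤ ((d : ℝ) + 1) ^ (1 / r) * ‖x‖ := by
  -- Using `d + 1` rather than `d` keeps the constant positive when `d = 0`, as the lower bound on
  -- the conjugate requires.
  have h : ∑ i, |x i| ^ r ≤ ((d : ℝ) + 1) * ‖x‖ ^ r := by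
    calc ∑ i, |x i| ^ r ≤ ∑ _i : Fin d, ‖x‖ ^ r := by
          gcongr with i
          exact PiLp.norm_apply_le x i
      _ = d * ‖x‖ ^ r := by simp
      _ ≤ ((d : ℝ) + 1) * ‖x‖ ^ r := by
          gcongr
          linarith
  calc lrNorm r x ≤ (((d : ℝ) + 1) * ‖x‖ ^ r) ^ (1 / r) :=
        Real.rpow_le_rpow (Finset.sum_nonneg fun _ _ => by positivity) h (by positivity)
    _ = ((d : ℝ) + 1) ^ (1 / r) * ‖x‖ := by
        rw [Real.mul_rpow (by positivity) (by positivity), ← Real.rpow_mul (norm_nonneg x),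
          mul_one_div_cancel hr.ne', Real.rpow_one]

theorem abs_apply_le_lrNorm (hr : 0 < r) (x : EuclideanSpace ℝ (Fin d)) (i : Fin d) :
    |x i| ≤ lrNorm r x := by
  calc |x i| = (|x i| ^ r) ^ (1 / r) := by
        rw [← Real.rpow_mul (abs_nonneg _), mul_one_div_cancel hr.ne', Real.rpow_one]
    _ ≤ lrNorm r x := by
        refine Real.rpow_le_rpow (by positivity) ?_ (by positivity)
        exact Finset.single_le_sum (f := fun i => |x i| ^ r) (fun _ _ => by positivity)
          (Finset.mem_univ i)

theorem norm_le_mul_lrNorm (hr : 0 < r) (x : EuclideanSpace ℝ (Fin d)) :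
    ‖x‖ ≤ d * lrNorm r x := by
  calc ‖x‖ = ‖∑ i, x i • EuclideanSpace.basisFun (Fin d) ℝ i‖ := by
        conv_lhs => rw [← (EuclideanSpace.basisFun (Fin d) ℝ).sum_repr x]
        simp
    _ ≤ ∑ _i : Fin d, lrNorm r x := by
        refine norm_sum_le_of_le _ fun i _ => ?_
        rw [norm_smul, OrthonormalBasis.norm_eq_one, mul_one]
        exact abs_apply_le_lrNorm hr x i
    _ = d * lrNorm r x := by simp

end LrNorm

theorem mainTheorem7 (d : ℕ) (r q : ℝ) (hr : 1 ≤ r) (hrq : r ≤ q) (hq : 2 ≤ q) :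
    ∃ C : ℝ≥0, GeneralizedNemirovsky.{u, 0} (powerG d r q) C := by
  have hr0 : 0 < r := by linarith
  exact generalizedNemirovsky_of_norm_equiv hq (by positivity) (Nat.cast_nonneg d)
    (lrNorm_nonneg r) (lrNorm_le_mul_norm hr0) (norm_le_mul_lrNorm hr0)
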